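/- Let $d,r,m\in\mathbb{N}$, $f_0:=1$ and $f_1,\dots,f_r\in\mathbb{R}[x_1,\dots,x_d]$, and let $g_1,\dots,g_m\in\mathbb{R}[x_1,\dots,x_d]$ be polynomials of degree one. For polynomials $h_1,\dots,h_s$ write $\mathcal{K}(h_1,\dots,h_s):=\{x\in\mathbb{R}^d : h_1(x)\ge 0,\dots,h_s(x)\ge 0\}$. Suppose that the polyhedron $\mathcal{K}(g_1,\dots,g_m)$ is nonempty and compact and contains $\mathcal{K}(f_1,\dots,f_r)$. (1) If $p\in\mathbb{R}[x_1,\dots,x_d]$ satisfies $p(x)>0$ for all $x\in\mathcal{K}(f_1,\dots,f_r)$, then $p$ is a finite sum of polynomials $$\alpha\, f_j\, g_1^{n_1}\cdots g_m^{n_m},\qquad \alpha\in(0,+\infty),\ j\in\{0,\dots,r\},\ n_1,\dots,n_m\in\mathbb{N}_0.$$ (2) Let $L$ be a linear functional on $\mathbb{R}[x_1,\dots,x_d]$ such that $L(f_j\, g_1^{n_1}\cdots g_m^{n_m})\ge 0$ for all $j\in\{0,\dots,r\}$ and $n_1,\dots,n_m\in\mathbb{N}_0$. Then $L$ is a $\mathcal{K}(f_1,\dots,f_r)$-moment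 functional, that is, there is a Radon measure $\mu$ on $\mathbb{R}^d$ supported on $\mathcal{K}(f_1,\dots,f_r)$ such that every polynomial $p$ is $\mu$-integrable and $L(p)=\int p\,d\mu$. -/

import Mathlib

/-- The basic closed semialgebraic set `K(f₁, …, f_r) = {x ∈ ℝ^d : f₁(x) ≥ 0, …, f_r(x) ≥ 0}`. -/
def semialgSet {d r : ℕ} (f : Fin r → MvPolynomial (Fin d) ℝ) : Set (Fin d → ℝ) :=
  {x | ∀ i, 0 ≤ MvPolynomial.eval x (f i)}

/-- The polynomial `f_j * g₁ ^ n₁ * ⋯ * g_m ^ n_m`, for `j = 0, …, r`, where `f₀ = 1`; the family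
`f` lists `f₁, …, f_r`. -/
noncomputable def singleFactorTerm {d r m : ℕ} (f : Fin r → MvPolynomial (Fin d) ℝ)
    (g : Fin m → MvPolynomial (Fin d) ℝ) (j : Fin (r + 1)) (n : Fin m → ℕ) :
    MvPolynomial (Fin d) ℝ :=
  (Fin.cons 1 f : Fin (r + 1) → MvPolynomial (Fin d) ℝ) j * ∏ k, g k ^ n k

/-- A linear functional `L` on `ℝ[x₁, …, x_d]` is a `K`-moment functional if there is a Radon
measure `μ` supported on the closed set `K` such that every polynomial `p` is `μ`-integrable and
`L p = ∫ p dμ`. -/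
def IsMomentFunctional {d : ℕ} (K : Set (Fin d → ℝ)) (L : MvPolynomial (Fin d) ℝ →ₗ[ℝ] ℝ) :
    Prop :=
  ∃ μ : MeasureTheory.Measure (Fin d → ℝ), μ.Regular ∧ μ Kᶜ = 0 ∧
    ∀ p : MvPolynomial (Fin d) ℝ,
      MeasureTheory.Integrable (fun x => MvPolynomial.eval x p) μ ∧
        L p = ∫ x, MvPolynomial.eval x p ∂μ

/-! Let M be the cone generated by the f_j g^n; it suffices to put every p positive on K(f) into M.
Each g_k multiplies M into itself. Compactness of K(g) enters by finite-dimensional duality: every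
linear form becomes a multiplier of M after adding a constant, and bounded elements form a
subalgebra, so every polynomial is bounded (`mem_coneBounded_of_isCompact`). If p were outside M,
separation would give a state of M nonpositive at p. States form a compact set, so some pure state
is nonpositive at p; pure states are multiplicative (`extreme_state_mul`), hence evaluations at
points, which lie in K(f) because the f_j are in M. This contradicts p > 0.

For (2), perturbing by small constants makes L nonnegative on polynomials nonnegative on the compact
set K(f), and Haviland's theorem applies. -/

/-- The multipliers `s` with `s * M ⊆ M`, for a cone `M` in a commutative real algebra. -/
def coneMultipliers {A : Type*} [CommRing A] [Algebra ℝ A] (M : PointedCone ℝ A) :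
    Subsemiring A where
  carrier := {s | ∀ a ∈ M, s * a ∈ M}
  mul_mem' {s t} hs ht a ha := by
    rw [mul_assoc]
    exact hs _ (ht _ ha)
  one_mem' a ha := by rwa [one_mul]
  add_mem' {s t} hs ht a ha := by
    rw [add_mul]
    exact M.add_mem (hs _ ha) (ht _ ha)
  zero_mem' a _ := by
    rw [zero_mul]
    exact M.zero_mem

/-- The linear functionals that are nonnegative on `M` and take the value `1` at `1`. -/
def coneStates {A : Type*} [CommRing A] [Algebra ℝ A] (M : PointedCone ℝ A) : Set (A → ℝ) :=
  Set.range ((⇑) : (A →ₗ[ℝ] ℝ) → A → ℝ) ∩ {L | L 1 = 1 ∧ ∀ a ∈ M, 0 ≤ L a}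

/-! ### Archimedean representation theorem via pure states -/

section Representation

variable {A : Type*} [CommRing A] [Algebra ℝ A] {M : PointedCone ℝ A}

theorem smul_mem_coneMultipliers {c : ℝ} (hc : 0 ≤ c) {s : A} (hs : s ∈ coneMultipliers M) :
    c • s ∈ coneMultipliers M := fun a ha => by
  rw [smul_mul_assoc]
  exact M.smul_mem hc (hs a ha)

theorem algebraMap_mem_coneMultipliers {c : ℝ} (hc : 0 ≤ c) :
    algebraMap ℝ A c ∈ coneMultipliers M := by
  rw [Algebra.algebraMap_eq_smul_one]
  exact smul_mem_coneMultipliers hc (one_mem _)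

theorem mem_of_mem_coneMultipliers (h1 : (1 : A) ∈ M) {s : A} (hs : s ∈ coneMultipliers M) :
    s ∈ M := by
  simpa using hs 1 h1

/-- The elements `a` with `c + a` and `c - a` in `coneMultipliers M` for some constant `c`. -/
def coneBounded (M : PointedCone ℝ A) : Subalgebra ℝ A where
  carrier := {a | ∃ c : ℝ, algebraMap ℝ A c + a ∈ coneMultipliers M ∧
    algebraMap ℝ A c - a ∈ coneMultipliers M}
  add_mem' := by
    rintro a b ⟨c, hc, hc'⟩ ⟨e, he, he'⟩
    refine ⟨c + e, ?_, ?_⟩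
    · convert! add_mem hc he using 1
      rw [map_add]
      ring
    · convert! add_mem hc' he' using 1
      rw [map_add]
      ring
  mul_mem' := by
    rintro a b ⟨c, hc, hc'⟩ ⟨e, he, he'⟩
    have half : ∀ {x y : A}, x ∈ coneMultipliers M → x = 2 * y → y ∈ coneMultipliers M := by
      intro x y hx h
      have := smul_mem_coneMultipliers (show (0 : ℝ) ≤ 1 / 2 by norm_num) hx
      rwa [h, two_mul, ← two_smul ℝ y, smul_smul, show (1 / 2 * 2 : ℝ) = 1 by norm_num,
        one_smul] at this
    -- Uses 2(ce ± ab) = (c + a)(e ± b) + (c - a)(e ∓ b).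
    refine ⟨c * e, half (add_mem (mul_mem hc he) (mul_mem hc' he')) ?_,
      half (add_mem (mul_mem hc' he) (mul_mem hc he')) ?_⟩ <;>
    · rw [map_mul]
      ring
  algebraMap_mem' c := by
    refine ⟨|c|, ?_, ?_⟩
    · rw [← map_add]
      exact algebraMap_mem_coneMultipliers (by linarith [neg_abs_le c])
    · rw [← map_sub]
      exact algebraMap_mem_coneMultipliers (by linarith [le_abs_self c])

theorem convex_coneStates : Convex ℝ (coneStates M) := by
  rintro _ ⟨⟨L, rfl⟩, hL1, hL⟩ _ ⟨⟨L', rfl⟩, hL1', hL'⟩ s t hs ht hst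
  refine ⟨⟨s • L + t • L', rfl⟩, ?_, fun a ha => ?_⟩
  · simp [hL1, hL1', hst]
  · have := mul_nonneg hs (hL a ha)
    have := mul_nonneg ht (hL' a ha)
    simpa using by linarith

/-- Tychonoff: bounds on ±a confine L a to a fixed interval, and all conditions are closed under
pointwise convergence. -/
theorem isCompact_coneStates (h : ∀ a : A, ∃ c : ℝ, algebraMap ℝ A c + a ∈ M) :
    IsCompact (coneStates M) := by
  choose c hc using h
  refine (isCompact_univ_pi fun a => isCompact_Icc (a := -c a) (b := c (-a))).of_isClosed_subset
    ?_ ?_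
  · refine (LinearMap.isClosed_range_coe A ℝ (RingHom.id ℝ)).inter ?_
    have : {L : A → ℝ | L 1 = 1 ∧ ∀ a ∈ M, 0 ≤ L a} =
        {L | L 1 = 1} ∩ ⋂ a ∈ M, {L | 0 ≤ L a} := by
      ext
      simp
    rw [this]
    exact (isClosed_eq (continuous_apply _) continuous_const).inter
      (isClosed_biInter fun a _ => isClosed_le continuous_const (continuous_apply _))
  · rintro _ ⟨⟨L, rfl⟩, hL1, hL⟩ a -
    have h1 := hL _ (hc a)
    have h2 := hL _ (hc (-a))
    simp only [Algebra.algebraMap_eq_smul_one, map_add, map_smul, hL1, smul_eq_mul, mul_one,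
      map_neg] at h1 h2
    exact ⟨by linarith, by linarith⟩

/-- Adjoining -p to M still leaves -1 outside, so the functional t·1 ↦ t is positive on the line of
constants and extends by M. Riesz. -/
theorem exists_state_nonpos (h1 : (1 : A) ∈ M)
    (h : ∀ a : A, ∃ c : ℝ, algebraMap ℝ A c + a ∈ M)
    {p : A} (hneg : (-1 : A) ∉ M) (hp : p ∉ M) : ∃ L ∈ coneStates M, L p ≤ 0 := by
  have hone : (1 : A) ≠ 0 := fun h0 => hneg (by simp [h0])
  let N : PointedCone ℝ A := M ⊔ PointedCone.hull ℝ {-p}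
  have hMN : M ≤ N := le_sup_left
  have hN : (-1 : A) ∉ N := by
    intro hmem
    obtain ⟨a, ha, b, hb, hab⟩ := Submodule.mem_sup.1 hmem
    obtain ⟨⟨t, ht⟩, rfl⟩ := Submodule.mem_span_singleton.1 hb
    replace hab : a + t • (-p) = -1 := hab
    -- For t > 0, a - tp = -1 would give p = (a + 1)/t in M.
    rcases ht.eq_or_lt with rfl | ht'
    · exact hneg (by simpa [← hab] using ha)
    · apply hp
      have := M.smul_mem (inv_nonneg.2 ht) (M.add_mem ha h1)
      rwa [show a + 1 = t • p by linear_combination hab - smul_neg t p, smul_smul,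
        inv_mul_cancel₀ ht'.ne', one_smul] at this
  obtain ⟨L, hL, hLN⟩ := riesz_extension N
    (LinearPMap.mkSpanSingleton' (σ := RingHom.id ℝ) (1 : A) (1 : ℝ) fun c hc => by
      rw [(smul_eq_zero.1 hc).resolve_right hone, map_zero, zero_smul])
    (by
      rintro ⟨x, hx⟩ hxN
      obtain ⟨t, rfl⟩ := Submodule.mem_span_singleton.1 hx
      rw [LinearPMap.mkSpanSingleton'_apply]
      simp only [RingHom.id_apply, smul_eq_mul, mul_one]
      by_contra! ht
      apply hN
      have := N.smul_mem (r := (-t)⁻¹) (inv_nonneg.2 (by linarith)) hxN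
      simp only [smul_smul] at this
      rwa [inv_neg, neg_mul, inv_mul_cancel₀ ht.ne, neg_smul, one_smul] at this)
    (fun y => by
      obtain ⟨c, hc⟩ := h y
      refine ⟨⟨c • 1, Submodule.mem_span_singleton.2 ⟨c, rfl⟩⟩, ?_⟩
      rw [Algebra.algebraMap_eq_smul_one] at hc
      exact hMN hc)
  refine ⟨L, ⟨⟨L, rfl⟩, ?_, fun a ha => hLN a (hMN ha)⟩, ?_⟩
  · have := (hL ⟨(1 : ℝ) • 1, Submodule.mem_span_singleton.2 ⟨1, rfl⟩⟩).trans
      (LinearPMap.mkSpanSingleton'_apply _ _ _ _ _)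
    simpa using this
  · have := hLN (-p) ((le_sup_right : _ ≤ N) (PointedCone.subset_hull rfl))
    rw [map_neg] at this
    linarith

/-- A pure state scales out the elements `s` of the unit interval of the multipliers. -/
theorem extreme_state_mul_of_mem (h : ∀ a : A, a ∈ coneBounded M) (h1 : (1 : A) ∈ M)
    {L : A →ₗ[ℝ] ℝ} (hL : ⇑L ∈ (coneStates M).extremePoints ℝ) {s : A}
    (hs : s ∈ coneMultipliers M) (hs' : 1 - s ∈ coneMultipliers M) (a : A) :
    L (s * a) = L s * L a := by
  obtain ⟨⟨-, hL1, hLM⟩, hext⟩ := hL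
  -- Both u(c + a) and u(c - a) lie in M, so ±L(ua) ≥ 0.
  have zero : ∀ {u : A}, u ∈ coneMultipliers M → L u = 0 → ∀ a, L (u * a) = 0 := by
    intro u hu h0 a
    obtain ⟨c, hc, hc'⟩ := h a
    have e1 := hLM _ (mem_of_mem_coneMultipliers h1 (mul_mem hu hc))
    have e2 := hLM _ (mem_of_mem_coneMultipliers h1 (mul_mem hu hc'))
    rw [mul_add, map_add, Algebra.algebraMap_eq_smul_one, mul_smul_comm, mul_one, map_smul, h0,
      smul_zero] at e1
    rw [mul_sub, map_sub, Algebra.algebraMap_eq_smul_one, mul_smul_comm, mul_one, map_smul, h0,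
      smul_zero] at e2
    linarith
  have state : ∀ {u : A}, u ∈ coneMultipliers M → 0 < L u →
      (fun a => (L u)⁻¹ * L (u * a)) ∈ coneStates M := by
    intro u hu hpos
    refine ⟨⟨(L u)⁻¹ • L ∘ₗ LinearMap.mulLeft ℝ u, rfl⟩, ?_, fun a ha => ?_⟩
    · simp [hpos.ne']
    · exact mul_nonneg (inv_nonneg.2 hpos.le) (hLM _ (hu a ha))
  have hs0 := hLM _ (mem_of_mem_coneMultipliers h1 hs)
  have hs1 := hLM _ (mem_of_mem_coneMultipliers h1 hs')
  have hsub : L (1 - s) = 1 - L s := by rw [map_sub, hL1]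
  have hsplit : ∀ a, L ((1 - s) * a) = L a - L (s * a) := fun a => by
    rw [sub_mul, one_mul, map_sub]
  rcases hs0.eq_or_lt with h0 | h0
  · rw [zero hs h0.symm, ← h0, zero_mul]
  rcases hs1.eq_or_lt with h2 | h2
  · have := zero hs' h2.symm a
    rw [hsplit] at this
    rw [hsub] at h2
    rw [show L s = 1 by linarith]
    linarith
  -- L is the convex combination, with weights L s and L(1 - s), of its normalised translates by s
  -- and 1 - s; extremality identifies L with the first.
  have key := hext (state hs h0) (state hs' h2) ⟨L s, L (1 - s), h0, h2, by rw [hsub]; ring, by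
    ext a
    simp only [Pi.add_apply, Pi.smul_apply, smul_eq_mul, mul_inv_cancel_left₀ h0.ne',
      mul_inv_cancel_left₀ h2.ne', hsplit]
    ring⟩
  have := congrFun key a
  field_simp at this
  exact this

/-- Rescaling a to s = (e + a)/(2e) puts s and 1 - s among the multipliers. -/
theorem extreme_state_mul (h : ∀ a : A, a ∈ coneBounded M) (h1 : (1 : A) ∈ M)
    {L : A →ₗ[ℝ] ℝ} (hL : ⇑L ∈ (coneStates M).extremePoints ℝ) (a b : A) :
    L (a * b) = L a * L b := by
  obtain ⟨c, hc, hc'⟩ := h a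
  obtain ⟨e, he, hpos⟩ : ∃ e : ℝ, c ≤ e ∧ 0 < e :=
    ⟨max c 1, le_max_left _ _, lt_max_of_lt_right one_pos⟩
  have hadd : ∀ {x : A}, algebraMap ℝ A c + x ∈ coneMultipliers M →
      algebraMap ℝ A e + x ∈ coneMultipliers M := fun {x} hx => by
    convert! add_mem hx (algebraMap_mem_coneMultipliers (sub_nonneg.2 he)) using 1
    rw [map_sub]
    ring
  have he1 := smul_mem_coneMultipliers (inv_nonneg.2 (by linarith : (0 : ℝ) ≤ 2 * e)) (hadd hc)
  have he2 : 1 - (2 * e)⁻¹ • (algebraMap ℝ A e + a) ∈ coneMultipliers M := by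
    rw [sub_eq_add_neg] at hc'
    convert! smul_mem_coneMultipliers (inv_nonneg.2 (by linarith : (0 : ℝ) ≤ 2 * e))
      (hadd hc') using 1
    have : (1 : A) = (2 * e)⁻¹ • (2 * e) • 1 := by
      rw [smul_smul, inv_mul_cancel₀ (by positivity), one_smul]
    rw [Algebra.algebraMap_eq_smul_one]
    nth_rewrite 1 [this]
    rw [← smul_sub, mul_smul, two_smul]
    congr 1
    abel
  have key := extreme_state_mul_of_mem h h1 hL he1 he2 b
  rw [smul_mul_assoc, add_mul, Algebra.algebraMap_eq_smul_one, smul_mul_assoc, one_mul] at key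
  simp only [map_smul, map_add, smul_eq_mul, hL.1.2.1, mul_one] at key
  field_simp at key
  linarith

/-- **Representation theorem** for modules over Archimedean semirings: an element on which every
character that is nonnegative on `M` is positive lies in `M`. -/
theorem mem_of_forall_character_pos (h : ∀ a : A, a ∈ coneBounded M) (h1 : (1 : A) ∈ M) {p : A}
    (hp : ∀ φ : A →ₐ[ℝ] ℝ, (∀ a ∈ M, 0 ≤ φ a) → 0 < φ p) : p ∈ M := by
  have hM : ∀ a : A, ∃ c : ℝ, algebraMap ℝ A c + a ∈ M := fun a => by
    obtain ⟨c, hc, -⟩ := h a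
    exact ⟨c, mem_of_mem_coneMultipliers h1 hc⟩
  by_contra hpM
  have hneg : (-1 : A) ∉ M := by
    intro hneg
    obtain ⟨c, hc⟩ := hM p
    apply hpM
    have hc0 : (-c) • (1 : A) ∈ M := by
      rcases le_total 0 c with h0 | h0
      · simpa using M.smul_mem h0 hneg
      · exact M.smul_mem (neg_nonneg.2 h0) h1
    have := M.add_mem hc hc0
    rwa [Algebra.algebraMap_eq_smul_one, neg_smul, add_neg_cancel_comm] at this
  obtain ⟨L₀, hL₀, hL₀p⟩ := exists_state_nonpos h1 hM hneg hpM
  -- States minimising L p form an exposed face, whose extreme points are pure states.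
  let l : StrongDual ℝ (A → ℝ) := -ContinuousLinearMap.proj p
  have hexp : IsExposed ℝ (coneStates M) (l.toExposed (coneStates M)) :=
    ContinuousLinearMap.toExposed.isExposed
  have hcomp := isCompact_coneStates hM
  obtain ⟨L₁, hL₁, hmin⟩ := hcomp.exists_isMaxOn ⟨L₀, hL₀⟩ l.continuous.continuousOn
  obtain ⟨L, hL⟩ := (hexp.isCompact hcomp).extremePoints_nonempty ⟨L₁, hL₁, hmin⟩
  have hLext := hexp.isExtreme.extremePoints_subset_extremePoints hL
  have hLp : L p ≤ 0 := by
    have : -L₀ p ≤ -L p := hL.1.2 L₀ hL₀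
    linarith
  obtain ⟨⟨Λ, rfl⟩, hΛ1, hΛM⟩ := hLext.1
  have := hp (AlgHom.ofLinearMap Λ hΛ1 (extreme_state_mul h h1 hLext)) hΛM
  exact absurd hLp (not_le.2 this)

end Representation

/-! ### Compact polyhedra and boundedness of polynomials -/

/-- A convex cone in a finite-dimensional space on which no nonzero functional is nonnegative is
the whole space. -/
theorem PointedCone.eq_top_of_forall_functional {E : Type*} [NormedAddCommGroup E]
    [NormedSpace ℝ E] [FiniteDimensional ℝ E] (C : PointedCone ℝ E)
    (h : ∀ f : StrongDual ℝ E, (∀ x ∈ C, 0 ≤ f x) → f = 0) (x : E) : x ∈ C := by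
  have hconv : Convex ℝ (C : Set E) := C.convex
  have hcl : closure (C : Set E) = Set.univ := by
    refine Set.eq_univ_of_forall fun y => ?_
    by_contra hy
    obtain ⟨f, hf, hfy⟩ := ProperCone.hyperplane_separation_point
      (⟨C.closure, isClosed_closure⟩ : ProperCone ℝ E) (x₀ := y) hy
    have := h f fun x hx => hf x (subset_closure hx)
    simp [this] at hfy
  have hspan : affineSpan ℝ (C : Set E) = ⊤ := by
    rw [eq_top_iff, ← SetLike.coe_subset_coe, AffineSubspace.top_coe, ← hcl]
    exact closure_minimal (subset_affineSpan ℝ _) (AffineSubspace.closed_of_finiteDimensional _)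
  have hint := hconv.interior_nonempty_iff_affineSpan_eq_top.2 hspan
  -- A dense convex set with nonempty interior is everything.
  have := hconv.interior_closure_eq_interior_of_nonempty_interior hint
  rw [hcl, interior_univ] at this
  exact interior_subset (this ▸ Set.mem_univ x)

namespace MvPolynomial

variable {σ : Type*} [Fintype σ]

theorem eq_C_add_sum_of_totalDegree_le_one {R : Type*} [CommRing R] {g : MvPolynomial σ R}
    (hg : g.totalDegree ≤ 1) :
    g = C (coeff 0 g) + ∑ i, C (coeff (Finsupp.single i 1) g) * X i := by
  classical
  ext n
  simp only [coeff_add, coeff_sum, coeff_C, coeff_C_mul, coeff_X]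
  by_cases h0 : n = 0
  · subst h0
    simp
  rw [if_neg (Ne.symm h0), zero_add]
  by_cases h1 : ∃ i, n = Finsupp.single i 1
  · obtain ⟨i, rfl⟩ := h1
    simp [Finsupp.single_left_inj]
  · push Not at h1
    rw [Finset.sum_eq_zero fun i _ => by rw [if_neg (Ne.symm (h1 i)), mul_zero]]
    by_contra hne
    have hd : n.degree ≤ 1 := (le_totalDegree (mem_support_iff.2 hne)).trans hg
    have hpos : n.degree ≠ 0 := by simpa [Finsupp.degree_eq_zero_iff] using h0
    obtain ⟨i, hi⟩ := (Finsupp.sum_eq_one_iff n).1 (show n.degree = 1 by omega)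
    exact h1 i hi

end MvPolynomial

/-- If a nonempty polyhedron is bounded, a direction along which no constraint decreases is
zero. -/
theorem eq_zero_of_isBounded_semialgSet {d m : ℕ} {g : Fin m → MvPolynomial (Fin d) ℝ}
    (hdeg : ∀ k, (g k).totalDegree ≤ 1) (hne : (semialgSet g).Nonempty)
    (hb : Bornology.IsBounded (semialgSet g)) {v : Fin d → ℝ}
    (hv : ∀ k, 0 ≤ ∑ i, (g k).coeff (Finsupp.single i 1) * v i) : v = 0 := by
  obtain ⟨x, hx⟩ := hne
  have hmem : ∀ t : ℝ, 0 ≤ t → x + t • v ∈ semialgSet g := by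
    intro t ht k
    have h1 := hx k
    have h2 := mul_nonneg ht (hv k)
    rw [MvPolynomial.eq_C_add_sum_of_totalDegree_le_one (hdeg k)] at h1 ⊢
    simp only [map_add, map_sum, map_mul, MvPolynomial.eval_C, MvPolynomial.eval_X, Pi.add_apply,
      Pi.smul_apply, smul_eq_mul, mul_add, Finset.sum_add_distrib] at h1 ⊢
    rw [Finset.mul_sum] at h2
    simp only [mul_left_comm _ t]
    linarith
  obtain ⟨R, hR⟩ := hb.exists_norm_le
  by_contra hv0
  have hpos : 0 < ‖v‖ := norm_pos_iff.2 hv0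
  have hRx := hR x hx
  have hR0 := (norm_nonneg x).trans hRx
  -- The multiple of v has norm 2R + 1, more than x can compensate, as ‖x‖ ≤ R.
  have h1 := hR _ (hmem ((2 * R + 1) / ‖v‖) (by positivity))
  have h2 := norm_sub_norm_le (((2 * R + 1) / ‖v‖) • v) (-x)
  rw [norm_neg, sub_neg_eq_add, add_comm _ x, norm_smul, Real.norm_of_nonneg (by positivity),
    div_mul_cancel₀ _ hpos.ne'] at h2
  linarith

/-- If the affine polynomials `g` cut out a nonempty compact polyhedron and multiplication by each
of them preserves the cone `M`, then every polynomial is bounded with respect to `M`. -/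
theorem mem_coneBounded_of_isCompact {d m : ℕ} {g : Fin m → MvPolynomial (Fin d) ℝ}
    (hdeg : ∀ k, (g k).totalDegree ≤ 1) (hne : (semialgSet g).Nonempty)
    (hcomp : IsCompact (semialgSet g)) {M : PointedCone ℝ (MvPolynomial (Fin d) ℝ)}
    (hg : ∀ k, g k ∈ coneMultipliers M) (p : MvPolynomial (Fin d) ℝ) : p ∈ coneBounded M := by
  classical
  let C : PointedCone ℝ (Fin d → ℝ) :=
    { carrier := {a | ∃ c : ℝ, MvPolynomial.C c + ∑ i, MvPolynomial.C (a i) * MvPolynomial.X i ∈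
        coneMultipliers M}
      add_mem' := by
        rintro a b ⟨c, hc⟩ ⟨e, he⟩
        refine ⟨c + e, ?_⟩
        convert! add_mem hc he using 1
        simp only [Pi.add_apply, map_add, add_mul, Finset.sum_add_distrib]
        ring
      zero_mem' := ⟨0, by simp⟩
      smul_mem' := by
        rintro ⟨t, ht⟩ a ⟨c, hc⟩
        refine ⟨t * c, ?_⟩
        convert! smul_mem_coneMultipliers ht hc using 1
        change _ + ∑ i, MvPolynomial.C (t * a i) * _ = _
        simp only [MvPolynomial.smul_eq_C_mul, map_mul, mul_add, Finset.mul_sum, mul_assoc] }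
  have hC : ∀ a, a ∈ C := by
    -- A functional nonnegative on C is a recession direction of the polyhedron, hence zero.
    refine C.eq_top_of_forall_functional fun f hf => ?_
    have hfe : ∀ a, f a = ∑ i, a i * f (Pi.single i 1) := fun a => by
      conv_lhs => rw [← Finset.univ_sum_single a, map_sum]
      refine Finset.sum_congr rfl fun i _ => ?_
      rw [← smul_eq_mul, ← map_smul, ← Pi.single_smul, smul_eq_mul, mul_one]
    have := eq_zero_of_isBounded_semialgSet hdeg hne hcomp.isBounded
      (v := fun i => f (Pi.single i 1)) fun k => by
        rw [← hfe fun i => (g k).coeff (Finsupp.single i 1)]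
        refine hf _ ⟨(g k).coeff 0, ?_⟩
        rw [← MvPolynomial.eq_C_add_sum_of_totalDegree_le_one (hdeg k)]
        exact hg k
    ext a
    rw [hfe]
    exact Finset.sum_eq_zero fun i _ => by rw [show f (Pi.single i 1) = 0 from congrFun this i,
      mul_zero]
  have hX : ∀ (t : ℝ) (i : Fin d), ∃ c : ℝ,
      MvPolynomial.C c + MvPolynomial.C t * MvPolynomial.X i ∈ coneMultipliers M := fun t i => by
    obtain ⟨c, hc⟩ := hC (Pi.single i t)
    refine ⟨c, ?_⟩
    rwa [Finset.sum_eq_single i (fun j _ hj => by simp [hj]) (by simp), Pi.single_eq_same] at hc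
  suffices h : (⊤ : Subalgebra ℝ (MvPolynomial (Fin d) ℝ)) ≤ coneBounded M from h trivial
  rw [← MvPolynomial.adjoin_range_X, Algebra.adjoin_le_iff]
  rintro _ ⟨i, rfl⟩
  obtain ⟨c, hc⟩ := hX 1 i
  obtain ⟨e, he⟩ := hX (-1) i
  refine ⟨|c| + |e|, ?_, ?_⟩
  · convert! add_mem hc (algebraMap_mem_coneMultipliers
      (by linarith [le_abs_self c, abs_nonneg e] : 0 ≤ |c| + |e| - c)) using 1
    simp only [MvPolynomial.algebraMap_eq, map_sub, map_one]
    ring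
  · convert! add_mem he (algebraMap_mem_coneMultipliers
      (by linarith [le_abs_self e, abs_nonneg c] : 0 ≤ |c| + |e| - e)) using 1
    simp only [MvPolynomial.algebraMap_eq, map_sub, map_neg, map_one]
    ring

/-! ### The cone of the theorem -/

theorem exists_sum_of_mem_hull_range {ι σ : Type*} {t : ι → MvPolynomial σ ℝ}
    {p : MvPolynomial σ ℝ} (hp : p ∈ PointedCone.hull ℝ (Set.range t)) :
    ∃ (N : ℕ) (α : Fin N → ℝ) (j : Fin N → ι), (∀ i, 0 < α i) ∧
      p = ∑ i, MvPolynomial.C (α i) * t (j i) := by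
  obtain ⟨c, rfl⟩ := Finsupp.mem_span_range_iff_exists_finsupp.1 hp
  let e := c.support.equivFin.symm
  refine ⟨_, fun i => (c (e i) : ℝ), fun i => (e i : ι), fun i => ?_, ?_⟩
  · exact lt_of_le_of_ne (c (e i)).2 fun h =>
      Finsupp.mem_support_iff.1 (e i).2 (Subtype.ext h.symm)
  · rw [Equiv.sum_comp e (fun i => MvPolynomial.C (c i : ℝ) * t i), Finsupp.sum,
      ← Finset.sum_coe_sort]
    refine Finset.sum_congr rfl fun i _ => ?_
    rw [← MvPolynomial.smul_eq_C_mul]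
    rfl

section Cone

variable {d r m : ℕ} (f : Fin r → MvPolynomial (Fin d) ℝ) (g : Fin m → MvPolynomial (Fin d) ℝ)

/-- The cone generated by the polynomials `f_j * g₁ ^ n₁ * ⋯ * g_m ^ n_m`. -/
noncomputable def singleFactorCone : PointedCone ℝ (MvPolynomial (Fin d) ℝ) :=
  PointedCone.hull ℝ (Set.range fun q : Fin (r + 1) × (Fin m → ℕ) => singleFactorTerm f g q.1 q.2)

theorem singleFactorTerm_mem_cone (j : Fin (r + 1)) (n : Fin m → ℕ) :
    singleFactorTerm f g j n ∈ singleFactorCone f g :=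
  PointedCone.subset_hull ⟨(j, n), rfl⟩

theorem one_mem_singleFactorCone : 1 ∈ singleFactorCone f g := by
  simpa [singleFactorTerm] using singleFactorTerm_mem_cone f g 0 0

theorem mem_coneMultipliers_singleFactorCone (k : Fin m) :
    g k ∈ coneMultipliers (singleFactorCone f g) := by
  intro a ha
  induction ha using Submodule.span_induction with
  | mem x hx =>
    obtain ⟨⟨j, n⟩, rfl⟩ := hx
    convert! singleFactorTerm_mem_cone f g j (n + Pi.single k 1) using 1
    simp only [singleFactorTerm, Pi.add_apply, pow_add, Finset.prod_mul_distrib]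
    rw [Finset.prod_eq_single (f := fun i => g i ^ (Pi.single k 1 : Fin m → ℕ) i) k
      (fun i _ hi => by simp [hi]) (by simp)]
    simp only [Pi.single_eq_same, pow_one]
    ring
  | zero => simp
  | add x y _ _ hx hy =>
    rw [mul_add]
    exact add_mem hx hy
  | smul c x _ hx =>
    rw [mul_smul_comm]
    exact Submodule.smul_mem _ _ hx

theorem mem_singleFactorCone_of_pos (hdeg : ∀ k, (g k).totalDegree ≤ 1)
    (hne : (semialgSet g).Nonempty) (hcomp : IsCompact (semialgSet g))
    {p : MvPolynomial (Fin d) ℝ} (hp : ∀ x ∈ semialgSet f, 0 < MvPolynomial.eval x p) :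
    p ∈ singleFactorCone f g := by
  refine mem_of_forall_character_pos
    (mem_coneBounded_of_isCompact hdeg hne hcomp (mem_coneMultipliers_singleFactorCone f g))
    (one_mem_singleFactorCone f g) fun φ hφ => ?_
  have heval : ∀ q, φ q = MvPolynomial.eval (fun i => φ (MvPolynomial.X i)) q := fun q => by
    conv_lhs => rw [MvPolynomial.aeval_unique φ]
    rw [← MvPolynomial.coe_aeval_eq_eval]
    rfl
  rw [heval]
  refine hp _ fun i => ?_
  rw [← heval]
  have := hφ _ (singleFactorTerm_mem_cone f g i.succ 0)
  simpa [singleFactorTerm] using this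

end Cone
-- Moment functionals on compact sets
open MeasureTheory

/-- **Riesz–Markov–Kakutani** on a compact space, for functionals on all continuous functions. -/
theorem exists_measure_of_positive_functional {X : Type*} [TopologicalSpace X] [T2Space X]
    [CompactSpace X] [MeasurableSpace X] [BorelSpace X] (G : C(X, ℝ) →ₗ[ℝ] ℝ)
    (hG : ∀ u : C(X, ℝ), 0 ≤ u → 0 ≤ G u) :
    ∃ μ : Measure X, IsFiniteMeasure μ ∧ ∀ u : C(X, ℝ), G u = ∫ x, u x ∂μ := by
  let Λ : CompactlySupportedContinuousMap X ℝ →ₚ[ℝ] ℝ :=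
    { toFun u := G u.toContinuousMap
      map_add' u v := G.map_add u.toContinuousMap v.toContinuousMap
      map_smul' c u := G.map_smul c u.toContinuousMap
      monotone' u v huv := by
        have := hG (v.toContinuousMap - u.toContinuousMap) fun x => sub_nonneg.2 (huv x)
        rw [map_sub] at this
        exact sub_nonneg.1 this }
  refine ⟨RealRMK.rieszMeasure Λ, inferInstance, fun u => ?_⟩
  exact (RealRMK.integral_rieszMeasure Λ (CompactlySupportedContinuousMap.continuousMapEquiv u)).symm

/-- **Haviland's theorem** for a compact set. -/
theorem isMomentFunctional_of_nonneg {d : ℕ} {K : Set (Fin d → ℝ)} (hK : IsCompact K)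
    (L : MvPolynomial (Fin d) ℝ →ₗ[ℝ] ℝ)
    (hL : ∀ p : MvPolynomial (Fin d) ℝ, (∀ x ∈ K, 0 ≤ MvPolynomial.eval x p) → 0 ≤ L p) :
    IsMomentFunctional K L := by
  have : CompactSpace K := isCompact_iff_compactSpace.1 hK
  let ev : MvPolynomial (Fin d) ℝ →ₗ[ℝ] C(K, ℝ) :=
    { toFun p := ⟨fun x => MvPolynomial.eval x.1 p,
        (MvPolynomial.continuous_eval p).comp continuous_subtype_val⟩
      map_add' p q := by ext; simp
      map_smul' c p := by ext; simp }
  have hev : ∀ p (x : K), ev p x = MvPolynomial.eval x.1 p := fun _ _ => rfl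
  -- A linear choice of polynomial representatives on K; L ignores the choice, since it kills
  -- polynomials vanishing on K.
  obtain ⟨s, hs⟩ := ev.rangeRestrict.exists_rightInverse_of_surjective ev.range_rangeRestrict
  have hs' : ∀ u : LinearMap.range ev, ev (s u) = u := fun u =>
    congrArg Subtype.val (LinearMap.congr_fun hs u)
  have hLs : ∀ p, L (s ⟨ev p, LinearMap.mem_range_self ev p⟩) = L p := by
    intro p
    have h0 : ∀ x ∈ K, MvPolynomial.eval x (s ⟨ev p, LinearMap.mem_range_self ev p⟩) =
        MvPolynomial.eval x p := fun x hx => DFunLike.congr_fun (hs' ⟨ev p, _⟩) (⟨x, hx⟩ : K)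
    have h1 := hL (s ⟨ev p, LinearMap.mem_range_self ev p⟩ - p) fun x hx => by simp [h0 x hx]
    have h2 := hL (p - s ⟨ev p, LinearMap.mem_range_self ev p⟩) fun x hx => by simp [h0 x hx]
    rw [map_sub] at h1 h2
    linarith
  obtain ⟨G, hG, hGpos⟩ := riesz_extension (PointedCone.positive ℝ C(K, ℝ))
    ⟨LinearMap.range ev, L ∘ₗ s⟩
    (fun u hu => hL _ fun x hx => by
      have h1 : ev (s u) ⟨x, hx⟩ = u.1 ⟨x, hx⟩ := by rw [hs']
      rw [← hev (s u) ⟨x, hx⟩, h1]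
      exact hu ⟨x, hx⟩)
    (fun y => ⟨⟨ev (MvPolynomial.C ‖y‖), LinearMap.mem_range_self _ _⟩, fun x => by
      have := neg_le_of_abs_le (y.norm_coe_le_norm x)
      simp [hev]
      linarith⟩)
  have hGL : ∀ p, G (ev p) = L p := fun p => (hG ⟨ev p, LinearMap.mem_range_self ev p⟩).trans (hLs p)
  obtain ⟨ν, hν, hνG⟩ := exists_measure_of_positive_functional G hGpos
  have hemb := MeasurableEmbedding.subtype_coe hK.measurableSet
  refine ⟨ν.map Subtype.val, inferInstance, ?_, fun p => ⟨?_, ?_⟩⟩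
  · rw [hemb.map_apply]
    simp
  · rw [hemb.integrable_map_iff]
    exact (ev p).continuous.integrable_of_hasCompactSupport (HasCompactSupport.of_compactSpace _)
  · rw [hemb.integral_map, ← hGL, hνG]
    rfl

theorem isClosed_semialgSet {d r : ℕ} (f : Fin r → MvPolynomial (Fin d) ℝ) :
    IsClosed (semialgSet f) := by
  have : semialgSet f = ⋂ i, {x | 0 ≤ MvPolynomial.eval x (f i)} := by
    ext
    simp [semialgSet]
  rw [this]
  exact isClosed_iInter fun i => isClosed_le continuous_const (MvPolynomial.continuous_eval _)

/-! ### Conclusion -/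

theorem corollary6p2 {d r m : ℕ} (f : Fin r → MvPolynomial (Fin d) ℝ)
    (g : Fin m → MvPolynomial (Fin d) ℝ) (hdeg : ∀ k, (g k).totalDegree = 1)
    (hne : (semialgSet g).Nonempty) (hcomp : IsCompact (semialgSet g))
    (hsub : semialgSet f ⊆ semialgSet g) :
    (∀ p : MvPolynomial (Fin d) ℝ, (∀ x ∈ semialgSet f, 0 < MvPolynomial.eval x p) →
      ∃ (N : ℕ) (α : Fin N → ℝ) (j : Fin N → Fin (r + 1)) (n : Fin N → Fin m → ℕ),
        (∀ i, 0 < α i) ∧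
          p = ∑ i, MvPolynomial.C (α i) * singleFactorTerm f g (j i) (n i)) ∧
    (∀ L : MvPolynomial (Fin d) ℝ →ₗ[ℝ] ℝ,
      (∀ (j : Fin (r + 1)) (n : Fin m → ℕ), 0 ≤ L (singleFactorTerm f g j n)) →
        IsMomentFunctional (semialgSet f) L) := by
  have hmem : ∀ p : MvPolynomial (Fin d) ℝ, (∀ x ∈ semialgSet f, 0 < MvPolynomial.eval x p) →
      p ∈ singleFactorCone f g := fun p =>
    mem_singleFactorCone_of_pos f g (fun k => (hdeg k).le) hne hcomp
  refine ⟨fun p hp => ?_, fun L hL => ?_⟩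
  · obtain ⟨N, α, q, hα, hpq⟩ := exists_sum_of_mem_hull_range (hmem p hp)
    exact ⟨N, α, fun i => (q i).1, fun i => (q i).2, hα, hpq⟩
  · have hLM : ∀ p ∈ singleFactorCone f g, 0 ≤ L p := by
      intro p hp
      obtain ⟨N, α, q, hα, rfl⟩ := exists_sum_of_mem_hull_range hp
      rw [map_sum]
      refine Finset.sum_nonneg fun i _ => ?_
      rw [← MvPolynomial.smul_eq_C_mul, map_smul]
      exact mul_nonneg (hα i).le (hL _ _)
    refine isMomentFunctional_of_nonneg
      (hcomp.of_isClosed_subset (isClosed_semialgSet f) hsub) L fun p hp => ?_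
    refine le_of_forall_pos_le_add fun ε hε => ?_
    have h1 := hLM 1 (one_mem_singleFactorCone f g)
    -- The added constant costs at most ε under L; the 1 in the denominator covers L 1 = 0.
    have h2 := hLM _ (hmem (p + MvPolynomial.C (ε / (L 1 + 1))) fun x hx => by
      rw [map_add, MvPolynomial.eval_C]
      exact add_pos_of_nonneg_of_pos (hp x hx) (by positivity))
    rw [map_add, ← mul_one (MvPolynomial.C _), ← MvPolynomial.smul_eq_C_mul, map_smul,
      smul_eq_mul] at h2
    have h3 : ε / (L 1 + 1) * L 1 ≤ ε := by
      rw [div_mul_eq_mul_div, div_le_iff₀ (by linarith)]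
      nlinarith
    linarith
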